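/- Consider the simply-typed $\lambda$-calculus with one base type $o$: types are $A ::= o \mid A \to A$, contexts are finite lists of types, and terms $\Gamma \vdash M : A$ are built from variables, abstraction and application. Fix an arbitrary set $\mathcal{C}$ (possibly empty or infinite), and write $\mathscr{M}_f(X)$ for the set of finite multisets over $X$. Let $\mathbf{Rel}$ be the Seely category of sets and relations ($\otimes$ and $\multimap$ given by the cartesian product of sets, the cartesian product $\&$ by disjoint union, $\top = \emptyset$, and $!X = \mathscr{M}_f(X)$ with its usual comonad structure). Let $\mathbf{ScottL}$ be the Seely category whose objects are preordered sets and whose morphisms from $A$ to $B$ are the relations $\alpha \subseteq A \times B$ that are down-closed in $A^{\mathrm{op}} \times B$, i.e. $(a,b) \in \alpha$, $a \leq_A a'$ and $b' \leq_B b$ imply $(a',b') \in \alpha$; composition is relational composition, and $\mathrm{id}_A = \{(a,a') \mid a' \leq_A a\}$. In it, $A \otimes B = A \times B$, $A \multimap B = A^{\mathrm{op}} \times B$, $A \,\&\, B = A + B$, $\top = \emptyset$, and $!A$ is $\mathscr{M}_f(A)$ with $\mu \leq_{!A} \nu$ iff every element of $\mu$ is $\leq_A$ some element of $\nu$; tensor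 of morphisms, pairing and currying are as in $\mathbf{Rel}$, projections and evaluation are the down-closures of those of $\mathbf{Rel}$, and \[ \begin{array}{rcl} !\alpha &=& \{(\mu,\nu) \mid \forall b \in \nu,\ \exists a \in \mu,\ (a,b) \in \alpha\},\\ \mathrm{der}_A &=& \{(\mu,a) \mid \exists a' \in \mu,\ a \leq_A a'\},\\ \mathrm{dig}_A &=& \{(\mu,[\mu_1,\dots,\mu_n]) \mid \forall i,\ \mu_i \leq_{!A} \mu\},\\ \mathsf{see}_{A_1,A_2} &=& \{((\mu_1,\mu_2),\nu) \mid \forall (i,a') \in \nu,\ \exists a \in \mu_i,\ a' \leq_{A_i} a\}. \end{array} \] Interpret the calculus in the standard way in the cartesian closed Kleisli categories $\mathbf{Rel}_!$ and $\mathbf{ScottL}_!$ (function space $A \Rightarrow B = {!A} \multimap B$, contexts interpreted by finite products), with $o$ interpreted as the set $\mathcal{C}$ in $\mathbf{Rel}_!$ and as $\mathcal{C}$ with the discrete preorder in $\mathbf{ScottL}_!$. Then types and contexts have the same underlying sets in both models, and a term $\Gamma \vdash M : A$ is interpreted as a relation $[\![M]\!]_{\mathbf{Rel}_!}$, respectively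 $[\![M]\!]_{\mathbf{ScottL}_!}$, from $\mathscr{M}_f([\![\Gamma]\!])$ to $[\![A]\!]$. Theorem. For every simply-typed $\lambda$-term $\Gamma \vdash M : A$, \[ [\![M]\!]_{\mathbf{ScottL}_!} \;=\; \bigl[\,[\![M]\!]_{\mathbf{Rel}_!}\,\bigr], \] where $[\,\cdot\,]$ is the down-closure in $(![\![\Gamma]\!])^{\mathrm{op}} \times [\![A]\!]$; that is, $(\mu,a) \in [\![M]\!]_{\mathbf{ScottL}_!}$ if and only if there is $(\mu',a') \in [\![M]\!]_{\mathbf{Rel}_!}$ with $\mu' \leq_{![\![\Gamma]\!]} \mu$ and $a \leq_{[\![A]\!]} a'$. -/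

import Mathlib

open scoped SetRel

universe u v w x

/-! ### The simply-typed `λ`-calculus over one base type -/

/-- Simple types: one base type `o` and arrow types. -/
inductive Ty : Type
  | base : Ty
  | arrow : Ty → Ty → Ty

/-- Typing contexts; the most recently bound variable comes first. -/
abbrev Ctx : Type := List Ty

/-- `Var Γ A`: the (de Bruijn) variables of type `A` in the context `Γ`. -/
inductive Var : Ctx → Ty → Type
  | here {Γ : Ctx} {A : Ty} : Var (A :: Γ) A
  | there {Γ : Ctx} {A B : Ty} : Var Γ A → Var (B :: Γ) A

/-- `Term Γ A`: the simply-typed `λ`-terms `Γ ⊢ M : A`. -/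
inductive Term : Ctx → Ty → Type
  | var {Γ : Ctx} {A : Ty} : Var Γ A → Term Γ A
  | lam {Γ : Ctx} {A B : Ty} : Term (A :: Γ) B → Term Γ (Ty.arrow A B)
  | app {Γ : Ctx} {A B : Ty} : Term Γ (Ty.arrow A B) → Term Γ A → Term Γ B

/-- The web of a simple type, the base type being interpreted by the set `C`:
`⟦o⟧ = C` and `⟦A → B⟧ = !⟦A⟧ ⊸ ⟦B⟧ = M_f(⟦A⟧) × ⟦B⟧`. -/
def Ty.web (C : Type u) : Ty → Type u
  | .base => C
  | .arrow A B => Multiset (Ty.web C A) × Ty.web C B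

/-- The web of a context: `⟦⟧ = ⊤ = ∅` and `⟦Γ, A⟧ = ⟦Γ⟧ & ⟦A⟧ = ⟦Γ⟧ + ⟦A⟧`. -/
def Ctx.web (C : Type u) : Ctx → Type u
  | [] => PEmpty
  | A :: Γ => Ctx.web C Γ ⊕ Ty.web C A

/-! ### The Seely category `Rel` of sets and relations

A morphism from `X` to `Y` is a relation `SetRel X Y`; identities and composition are Mathlib's
`SetRel.id` and `R ○ S` (first `R`, then `S`). On objects: `X ⊗ Y = X ⊸ Y = X × Y`,
`X & Y = X ⊕ Y`, `⊤ = ∅` and `! X = Multiset X`. -/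

namespace RelModel

variable {X : Type u} {Y : Type v} {Z : Type w} {W : Type x}

/-- Functorial action of the tensor product. -/
def tensor (R : SetRel X Z) (S : SetRel Y W) : SetRel (X × Y) (Z × W) :=
  {p | (p.1.1, p.2.1) ∈ R ∧ (p.1.2, p.2.2) ∈ S}

/-- First projection `X & Y → X`. -/
def fst : SetRel (X ⊕ Y) X := {p | p.1 = Sum.inl p.2}

/-- Second projection `X & Y → Y`. -/
def snd : SetRel (X ⊕ Y) Y := {p | p.1 = Sum.inr p.2}

/-- Pairing `Z → X & Y`. -/
def pair (R : SetRel Z X) (S : SetRel Z Y) : SetRel Z (X ⊕ Y) :=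
  {p | (∃ a, p.2 = Sum.inl a ∧ (p.1, a) ∈ R) ∨ (∃ b, p.2 = Sum.inr b ∧ (p.1, b) ∈ S)}

/-- Currying, from `Z ⊗ X → Y` to `Z → (X ⊸ Y)`. -/
def curry (R : SetRel (Z × X) Y) : SetRel Z (X × Y) :=
  {p | ((p.1, p.2.1), p.2.2) ∈ R}

/-- Evaluation `(X ⊸ Y) ⊗ X → Y`. -/
def ev : SetRel ((X × Y) × X) Y := {p | p.1.1 = (p.1.2, p.2)}

/-- Functorial action of `!`: the pairs `([a₁, …, aₙ], [b₁, …, bₙ])` with `(aᵢ, bᵢ) ∈ R`. -/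
def bangMap (R : SetRel X Y) : SetRel (Multiset X) (Multiset Y) :=
  {p | Multiset.Rel (fun a b => (a, b) ∈ R) p.1 p.2}

/-- Dereliction `! X → X`. -/
def der : SetRel (Multiset X) X := {p | p.1 = {p.2}}

/-- Digging `! X → ! ! X`. -/
def dig : SetRel (Multiset X) (Multiset (Multiset X)) := {p | p.1 = p.2.sum}

/-- Seely morphism `! X ⊗ ! Y → ! (X & Y)`. -/
def see : SetRel (Multiset X × Multiset Y) (Multiset (X ⊕ Y)) :=
  {p | p.2 = p.1.1.map Sum.inl + p.1.2.map Sum.inr}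

/-- Inverse of the Seely morphism. -/
def seeInv : SetRel (Multiset (X ⊕ Y)) (Multiset X × Multiset Y) := SetRel.inv see

/-- Composition in the Kleisli category of `!`, in diagrammatic order: first `R`, then `S`. -/
def kcomp (R : SetRel (Multiset X) Y) (S : SetRel (Multiset Y) Z) : SetRel (Multiset X) Z :=
  dig ○ bangMap R ○ S

/-- First Kleisli projection. -/
def kfst : SetRel (Multiset (X ⊕ Y)) X := der ○ fst

/-- Second Kleisli projection. -/
def ksnd : SetRel (Multiset (X ⊕ Y)) Y := der ○ snd

/-- Kleisli currying, with function space `X ⇒ Y = ! X ⊸ Y`. -/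
def kcurry (R : SetRel (Multiset (Z ⊕ X)) Y) : SetRel (Multiset Z) (Multiset X × Y) :=
  curry (see ○ R)

/-- Kleisli evaluation `(X ⇒ Y) & X → Y`. -/
def kev : SetRel (Multiset ((Multiset X × Y) ⊕ X)) Y :=
  seeInv ○ tensor der SetRel.id ○ ev

end RelModel

/-- Interpretation of variables in the cartesian closed category `Rel_!`. -/
def Var.rel (C : Type u) : {Γ : Ctx} → {A : Ty} → Var Γ A →
    SetRel (Multiset (Ctx.web C Γ)) (Ty.web C A)
  | _, _, .here => RelModel.ksnd
  | _, _, .there x => RelModel.kcomp RelModel.kfst (Var.rel C x)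

/-- Interpretation of terms in the cartesian closed category `Rel_!`. -/
def Term.rel (C : Type u) : {Γ : Ctx} → {A : Ty} → Term Γ A →
    SetRel (Multiset (Ctx.web C Γ)) (Ty.web C A)
  | _, _, .var x => Var.rel C x
  | _, _, .lam M => RelModel.kcurry (Term.rel C M)
  | _, _, .app M N => RelModel.kcomp (RelModel.pair (Term.rel C M) (Term.rel C N)) RelModel.kev

/-! ### The Seely category `ScottL` of preorders and down-closed relations

An object is a set `X` together with a preorder `P : PreorderOn X`. -/

namespace ScottL

/-- A preorder on the set `X`. This is Mathlib's `Preorder X` as a plain structure rather than a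
class: the preorders needed on multisets and on products are not the ones that instance resolution
finds. -/
structure PreorderOn (X : Type u) where
  le : X → X → Prop
  le_refl : ∀ a, le a a
  le_trans : ∀ a b c, le a b → le b c → le a c

variable {X : Type u} {Y : Type v} {Z : Type w} {W : Type x}

/-- The discrete preorder. -/
def discrete (X : Type u) : PreorderOn X where
  le a b := a = b
  le_refl _ := rfl
  le_trans _ _ _ := Eq.trans

/-- `P ⊗ Q`: the product preorder. -/
def tensorObj (P : PreorderOn X) (Q : PreorderOn Y) : PreorderOn (X × Y) where
  le p q := P.le p.1 q.1 ∧ Q.le p.2 q.2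
  le_refl p := ⟨P.le_refl p.1, Q.le_refl p.2⟩
  le_trans _ _ _ h k := ⟨P.le_trans _ _ _ h.1 k.1, Q.le_trans _ _ _ h.2 k.2⟩

/-- `P ⊸ Q = Pᵒᵖ × Q`. -/
def lolli (P : PreorderOn X) (Q : PreorderOn Y) : PreorderOn (X × Y) where
  le p q := P.le q.1 p.1 ∧ Q.le p.2 q.2
  le_refl p := ⟨P.le_refl p.1, Q.le_refl p.2⟩
  le_trans _ _ _ h k := ⟨P.le_trans _ _ _ k.1 h.1, Q.le_trans _ _ _ h.2 k.2⟩

/-- `P & Q`: the disjoint union of preorders. -/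
def withObj (P : PreorderOn X) (Q : PreorderOn Y) : PreorderOn (X ⊕ Y) where
  le := Sum.LiftRel P.le Q.le
  le_refl
    | .inl a => .inl (P.le_refl a)
    | .inr b => .inr (Q.le_refl b)
  le_trans
    | _, _, _, .inl h, .inl k => .inl (P.le_trans _ _ _ h k)
    | _, _, _, .inr h, .inr k => .inr (Q.le_trans _ _ _ h k)

/-- `! P`: finite multisets, with `μ ≤ ν` iff every element of the support of `μ` is below some
element of the support of `ν`. -/
def bang (P : PreorderOn X) : PreorderOn (Multiset X) where
  le μ ν := ∀ a ∈ μ, ∃ a' ∈ ν, P.le a a'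
  le_refl _ a ha := ⟨a, ha, P.le_refl a⟩
  le_trans _ _ _ h k a ha :=
    let ⟨b, hb, hab⟩ := h a ha
    let ⟨c, hc, hbc⟩ := k b hb
    ⟨c, hc, P.le_trans _ _ _ hab hbc⟩

/-- The down-closure `[S]` of a subset `S` of a preordered set. -/
def downClosure (P : PreorderOn X) (S : Set X) : Set X := {a | ∃ b ∈ S, P.le a b}

/-- Morphisms of `ScottL` from `P` to `Q`: the relations that are down-closed in `Pᵒᵖ × Q`. -/
structure Hom (P : PreorderOn X) (Q : PreorderOn Y) where
  rel : SetRel X Y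
  down : ∀ {a a' b b'}, (a, b) ∈ rel → P.le a a' → Q.le b' b → (a', b') ∈ rel

variable {P : PreorderOn X} {Q : PreorderOn Y} {T : PreorderOn Z} {U : PreorderOn W}

/-- The down-closure of a relation, as a morphism of `ScottL`. -/
def Hom.closure (P : PreorderOn X) (Q : PreorderOn Y) (R : SetRel X Y) : Hom P Q where
  rel := downClosure (lolli P Q) R
  down := fun ⟨c, hc, h1, h2⟩ ha hb =>
    ⟨c, hc, P.le_trans _ _ _ h1 ha, Q.le_trans _ _ _ hb h2⟩

/-- Identities. -/
def id (P : PreorderOn X) : Hom P P where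
  rel := {p | P.le p.2 p.1}
  down h ha hb := P.le_trans _ _ _ hb (P.le_trans _ _ _ h ha)

/-- Composition, in diagrammatic order: first `f`, then `g`. -/
def comp (f : Hom P Q) (g : Hom Q T) : Hom P T where
  rel := f.rel ○ g.rel
  down := fun ⟨c, h1, h2⟩ ha hb =>
    ⟨c, f.down h1 ha (Q.le_refl c), g.down h2 (Q.le_refl c) hb⟩

/-- Functorial action of the tensor product, as in `Rel`. -/
def tensor (f : Hom P T) (g : Hom Q U) : Hom (tensorObj P Q) (tensorObj T U) where
  rel := RelModel.tensor f.rel g.rel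
  down h ha hb := ⟨f.down h.1 ha.1 hb.1, g.down h.2 ha.2 hb.2⟩

/-- First projection: the down-closure of that of `Rel`. -/
def fst (P : PreorderOn X) (Q : PreorderOn Y) : Hom (withObj P Q) P :=
  Hom.closure _ _ RelModel.fst

/-- Second projection: the down-closure of that of `Rel`. -/
def snd (P : PreorderOn X) (Q : PreorderOn Y) : Hom (withObj P Q) Q :=
  Hom.closure _ _ RelModel.snd

/-- Pairing, as in `Rel`. -/
def pair (f : Hom T P) (g : Hom T Q) : Hom T (withObj P Q) where
  rel := RelModel.pair f.rel g.rel
  down := by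
    rintro a a' b b' (⟨c, hc, h⟩ | ⟨c, hc, h⟩) ha hb <;> cases hc <;> cases hb
    · exact Or.inl ⟨_, rfl, f.down h ha ‹_›⟩
    · exact Or.inr ⟨_, rfl, g.down h ha ‹_›⟩

/-- Currying, as in `Rel`. -/
def curry (f : Hom (tensorObj T P) Q) : Hom T (lolli P Q) where
  rel := RelModel.curry f.rel
  down h ha hb := f.down h ⟨ha, hb.1⟩ hb.2

/-- Evaluation: the down-closure of that of `Rel`. -/
def ev (P : PreorderOn X) (Q : PreorderOn Y) : Hom (tensorObj (lolli P Q) P) Q :=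
  Hom.closure _ _ RelModel.ev

/-- Functorial action of `!`. -/
def bangMap (f : Hom P Q) : Hom (bang P) (bang Q) where
  rel := {p | ∀ b ∈ p.2, ∃ a ∈ p.1, (a, b) ∈ f.rel}
  down h ha hb b hbm :=
    let ⟨c, hc, hbc⟩ := hb b hbm
    let ⟨d, hd, hdc⟩ := h c hc
    let ⟨e, he, hde⟩ := ha d hd
    ⟨e, he, f.down hdc hde hbc⟩

/-- Dereliction. -/
def der (P : PreorderOn X) : Hom (bang P) P where
  rel := {p | ∃ a' ∈ p.1, P.le p.2 a'}
  down := fun ⟨c, hc, h⟩ ha hb =>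
    let ⟨d, hd, hcd⟩ := ha c hc
    ⟨d, hd, P.le_trans _ _ _ hb (P.le_trans _ _ _ h hcd)⟩

/-- Digging. -/
def dig (P : PreorderOn X) : Hom (bang P) (bang (bang P)) where
  rel := {p | ∀ ν ∈ p.2, (bang P).le ν p.1}
  down h ha hb ν hν :=
    let ⟨ξ, hξ, hle⟩ := hb ν hν
    (bang P).le_trans _ _ _ hle ((bang P).le_trans _ _ _ (h ξ hξ) ha)

/-- Seely morphism `! P ⊗ ! Q → ! (P & Q)`. -/
def see (P : PreorderOn X) (Q : PreorderOn Y) :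
    Hom (tensorObj (bang P) (bang Q)) (bang (withObj P Q)) where
  rel := {p | (∀ a', Sum.inl a' ∈ p.2 → ∃ a ∈ p.1.1, P.le a' a) ∧
    (∀ b', Sum.inr b' ∈ p.2 → ∃ b ∈ p.1.2, Q.le b' b)}
  down := by
    rintro ⟨μ₁, μ₂⟩ ⟨μ₁', μ₂'⟩ ν ν' ⟨h1, h2⟩ ⟨k1, k2⟩ hν
    constructor
    · intro a ha
      obtain ⟨_, hc, hac⟩ := hν _ ha
      obtain ⟨hac⟩ | _ := hac
      obtain ⟨d, hd, hcd⟩ := h1 _ hc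
      obtain ⟨e, he, hde⟩ := k1 _ hd
      exact ⟨e, he, P.le_trans _ _ _ hac (P.le_trans _ _ _ hcd hde)⟩
    · intro b hb
      obtain ⟨_, hc, hbc⟩ := hν _ hb
      obtain _ | ⟨hbc⟩ := hbc
      obtain ⟨d, hd, hcd⟩ := h2 _ hc
      obtain ⟨e, he, hde⟩ := k2 _ hd
      exact ⟨e, he, Q.le_trans _ _ _ hbc (Q.le_trans _ _ _ hcd hde)⟩

/-- Inverse of the Seely morphism: the down-closure of that of `Rel`. -/
def seeInv (P : PreorderOn X) (Q : PreorderOn Y) :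
    Hom (bang (withObj P Q)) (tensorObj (bang P) (bang Q)) :=
  Hom.closure _ _ RelModel.seeInv

/-- Composition in the Kleisli category of `!`, in diagrammatic order: first `f`, then `g`. -/
def kcomp (f : Hom (bang P) Q) (g : Hom (bang Q) T) : Hom (bang P) T :=
  comp (comp (dig P) (bangMap f)) g

/-- First Kleisli projection. -/
def kfst (P : PreorderOn X) (Q : PreorderOn Y) : Hom (bang (withObj P Q)) P :=
  comp (der _) (fst P Q)

/-- Second Kleisli projection. -/
def ksnd (P : PreorderOn X) (Q : PreorderOn Y) : Hom (bang (withObj P Q)) Q :=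
  comp (der _) (snd P Q)

/-- Kleisli currying, with function space `P ⇒ Q = ! P ⊸ Q`. -/
def kcurry (f : Hom (bang (withObj T P)) Q) : Hom (bang T) (lolli (bang P) Q) :=
  curry (comp (see T P) f)

/-- Kleisli evaluation `(P ⇒ Q) & P → Q`. -/
def kev (P : PreorderOn X) (Q : PreorderOn Y) : Hom (bang (withObj (lolli (bang P) Q) P)) Q :=
  comp (comp (seeInv _ _) (tensor (der _) (id _))) (ev (bang P) Q)

end ScottL

/-- Interpretation of types in `ScottL_!`: the base type is the discrete preorder on `C`, and
`⟦A → B⟧ = !⟦A⟧ ⊸ ⟦B⟧`. -/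
def Ty.scott (C : Type u) : (A : Ty) → ScottL.PreorderOn (Ty.web C A)
  | .base => ScottL.discrete C
  | .arrow A B => ScottL.lolli (ScottL.bang (Ty.scott C A)) (Ty.scott C B)

/-- Interpretation of contexts in `ScottL_!`: `⟦⟧ = ⊤` and `⟦Γ, A⟧ = ⟦Γ⟧ & ⟦A⟧`. -/
def Ctx.scott (C : Type u) : (Γ : Ctx) → ScottL.PreorderOn (Ctx.web C Γ)
  | [] => ScottL.discrete PEmpty
  | A :: Γ => ScottL.withObj (Ctx.scott C Γ) (Ty.scott C A)

/-- Interpretation of variables in the cartesian closed category `ScottL_!`. -/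
def Var.scott (C : Type u) : {Γ : Ctx} → {A : Ty} → Var Γ A →
    ScottL.Hom (ScottL.bang (Ctx.scott C Γ)) (Ty.scott C A)
  | _, _, .here => ScottL.ksnd _ _
  | _, _, .there x => ScottL.kcomp (ScottL.kfst _ _) (Var.scott C x)

/-- Interpretation of terms in the cartesian closed category `ScottL_!`. -/
def Term.scott (C : Type u) : {Γ : Ctx} → {A : Ty} → Term Γ A →
    ScottL.Hom (ScottL.bang (Ctx.scott C Γ)) (Ty.scott C A)
  | _, _, .var x => Var.scott C x
  | _, _, .lam M => ScottL.kcurry (Term.scott C M)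
  | _, _, .app M N =>
      ScottL.kcomp (ScottL.pair (Term.scott C M) (Term.scott C N)) (ScottL.kev _ _)

/-! ### The extensional collapse

The proof is by a logical relation on the webs. A set `s ⊆ ⟦A → B⟧` is adequate when applying it, in
the sense of `Rel_!`, to adequate sets gives adequate sets and commutes with down-closure. Every
down-closed set is adequate, which makes the fundamental lemma go through for abstractions.
-/

/-! Every structural morphism of `Rel` lies in its `ScottL` counterpart, and `ScottL` morphisms are
down-closed; this yields the inclusion from right to left (`Term.rel_subset_scott`). The converse
cannot be proved by a bare induction, because down-closure does not commute with relational
composition: an argument supplied in `Rel_!` may only dominate the one a function asks for. The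
induction is therefore strengthened to the logical relation `Ty.Adequate`, under which such a
mismatch can be absorbed after closing the result downwards. Multiplicities are handled by passing
from a relation to its `image` on subsets: Kleisli composition becomes composition of functions
(`image_kcomp`), and on the `ScottL` side only supports matter. Since down-closed sets are adequate,
`Term.adequate` applies to the down-closure of the support of `μ`; a multiset drawn from that set is
exactly one below `μ`. -/

/-! ### Kleisli structure of `Rel_!` through its action on subsets. -/

namespace RelModel

variable {X : Type u} {Y : Type v} {Z : Type w}

/-- The action of a morphism of `Rel_!` on subsets. -/
def image (R : SetRel (Multiset X) Y) (s : Set X) : Set Y :=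
  {b | ∃ m, (m, b) ∈ R ∧ ∀ a ∈ m, a ∈ s}

/-- Choose a witness multiset for each occurrence in `ν` and add them up; `s` bounds only the
support, so the sum is still drawn from `s`. -/
theorem exists_sum_of_forall_mem_image (R : SetRel (Multiset X) Y) (s : Set X) (ν : Multiset Y)
    (h : ∀ b ∈ ν, b ∈ image R s) :
    ∃ ξ : Multiset (Multiset X), (ξ, ν) ∈ bangMap R ∧ ∀ a ∈ ξ.sum, a ∈ s := by
  induction ν using Multiset.induction_on with
  | empty => exact ⟨0, Multiset.Rel.zero, by simp⟩
  | cons b ν ih =>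
    obtain ⟨ξ, hξ, hs⟩ := ih fun c hc => h c (Multiset.mem_cons_of_mem hc)
    obtain ⟨m, hm, hms⟩ := h b (Multiset.mem_cons_self b ν)
    refine ⟨m ::ₘ ξ, Multiset.Rel.cons hm hξ, fun a ha => ?_⟩
    rw [Multiset.sum_cons, Multiset.mem_add] at ha
    exact ha.elim (hms a) (hs a)

theorem image_kcomp (R : SetRel (Multiset X) Y) (S : SetRel (Multiset Y) Z) (s : Set X) :
    image (kcomp R S) s = image S (image R s) := by
  ext c
  constructor
  · rintro ⟨μ, ⟨ν, ⟨ξ, hdig, hR⟩, hS⟩, hμ⟩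
    refine ⟨ν, hS, fun b hb => ?_⟩
    obtain ⟨m, hm, hmb⟩ := Multiset.exists_mem_of_rel_of_mem (Multiset.rel_flip.2 hR) hb
    refine ⟨m, hmb, fun a ha => hμ a ?_⟩
    change μ = ξ.sum at hdig
    exact hdig ▸ Multiset.mem_of_le (Multiset.single_le_sum (by simp) m hm) ha
  · rintro ⟨ν, hS, hν⟩
    obtain ⟨ξ, hξ, hs⟩ := exists_sum_of_forall_mem_image R s ν hν
    exact ⟨ξ.sum, ⟨ν, ⟨ξ, rfl, hξ⟩, hS⟩, hs⟩

theorem mem_kfst {m : Multiset (X ⊕ Y)} {a : X} : (m, a) ∈ kfst ↔ m = {Sum.inl a} := by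
  constructor
  · rintro ⟨c, hder, hfst⟩
    change m = {c} at hder
    change c = Sum.inl a at hfst
    rw [hder, hfst]
  · rintro rfl
    exact ⟨Sum.inl a, rfl, rfl⟩

theorem mem_ksnd {m : Multiset (X ⊕ Y)} {b : Y} : (m, b) ∈ ksnd ↔ m = {Sum.inr b} := by
  constructor
  · rintro ⟨c, hder, hsnd⟩
    change m = {c} at hder
    change c = Sum.inr b at hsnd
    rw [hder, hsnd]
  · rintro rfl
    exact ⟨Sum.inr b, rfl, rfl⟩

theorem image_kfst (s : Set (X ⊕ Y)) : image kfst s = Sum.inl ⁻¹' s := by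
  ext a
  constructor
  · rintro ⟨μ, h, hμ⟩
    exact hμ _ (mem_kfst.1 h ▸ Multiset.mem_singleton_self _)
  · intro ha
    exact ⟨{Sum.inl a}, mem_kfst.2 rfl, by simpa using ha⟩

theorem image_ksnd (s : Set (X ⊕ Y)) : image ksnd s = Sum.inr ⁻¹' s := by
  ext a
  constructor
  · rintro ⟨μ, h, hμ⟩
    exact hμ _ (mem_ksnd.1 h ▸ Multiset.mem_singleton_self _)
  · intro ha
    exact ⟨{Sum.inr a}, mem_ksnd.2 rfl, by simpa using ha⟩

theorem inl_mem_image_pair {R : SetRel (Multiset Z) X} {S : SetRel (Multiset Z) Y} {s : Set Z}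
    {a : X} : Sum.inl a ∈ image (pair R S) s ↔ a ∈ image R s := by
  simp [image, pair]

theorem inr_mem_image_pair {R : SetRel (Multiset Z) X} {S : SetRel (Multiset Z) Y} {s : Set Z}
    {b : Y} : Sum.inr b ∈ image (pair R S) s ↔ b ∈ image S s := by
  simp [image, pair]

theorem mem_kev {m : Multiset ((Multiset X × Y) ⊕ X)} {b : Y} :
    (m, b) ∈ kev ↔ ∃ n : Multiset X, m = Sum.inl (n, b) ::ₘ n.map Sum.inr := by
  constructor
  · rintro ⟨⟨_, n⟩, ⟨⟨_, n'⟩, hsee, hder, hid⟩, hev⟩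
    change _ = (n, b) at hev
    change n' = n at hid
    subst hev hid
    change _ = {(n', b)} at hder
    subst hder
    exact ⟨n', by simpa [seeInv, see] using hsee⟩
  · rintro ⟨n, rfl⟩
    exact ⟨((n, b), n), ⟨({(n, b)}, n), by simp [seeInv, see], rfl, rfl⟩, rfl⟩

theorem image_kev (s : Set ((Multiset X × Y) ⊕ X)) :
    image kev s = image (Sum.inl ⁻¹' s) (Sum.inr ⁻¹' s) := by
  ext b
  constructor
  · rintro ⟨m, hm, hs⟩
    obtain ⟨n, rfl⟩ := mem_kev.1 hm
    exact ⟨n, hs _ (Multiset.mem_cons_self _ _), fun a ha =>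
      hs _ (Multiset.mem_cons_of_mem (Multiset.mem_map_of_mem _ ha))⟩
  · rintro ⟨n, hn, hs⟩
    refine ⟨_, mem_kev.2 ⟨n, rfl⟩, fun a ha => ?_⟩
    rcases Multiset.mem_cons.1 ha with rfl | ha
    · exact hn
    · obtain ⟨c, hc, rfl⟩ := Multiset.mem_map.1 ha
      exact hs c hc

/-- Application of terms acts on environments by application of the images. -/
theorem image_kcomp_pair_kev (R : SetRel (Multiset Z) (Multiset X × Y))
    (S : SetRel (Multiset Z) X) (s : Set Z) :
    image (kcomp (pair R S) kev) s = image (image R s) (image S s) := by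
  rw [image_kcomp, image_kev]
  congr 1
  · ext; exact inl_mem_image_pair
  · ext; exact inr_mem_image_pair

theorem mem_kcurry {R : SetRel (Multiset (Z ⊕ X)) Y} {μ : Multiset Z} {m : Multiset X} {b : Y} :
    (μ, (m, b)) ∈ kcurry R ↔ (μ.map Sum.inl + m.map Sum.inr, b) ∈ R := by
  constructor
  · rintro ⟨ν, hν, h⟩
    change ν = _ at hν
    exact hν ▸ h
  · intro h
    exact ⟨μ.map Sum.inl + m.map Sum.inr, rfl, h⟩

theorem exists_map_inl_add_map_inr (ν : Multiset (X ⊕ Y)) :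
    ∃ (μ : Multiset X) (m : Multiset Y), ν = μ.map Sum.inl + m.map Sum.inr := by
  induction ν using Multiset.induction_on with
  | empty => exact ⟨0, 0, rfl⟩
  | cons c ν ih =>
    obtain ⟨μ, m, rfl⟩ := ih
    rcases c with a | b
    · exact ⟨a ::ₘ μ, m, by simp⟩
    · exact ⟨μ, b ::ₘ m, by simp⟩

theorem forall_mem_map_add_map {μ : Multiset X} {m : Multiset Y} {p : X ⊕ Y → Prop} :
    (∀ c ∈ μ.map Sum.inl + m.map Sum.inr, p c) ↔
      (∀ a ∈ μ, p (Sum.inl a)) ∧ ∀ b ∈ m, p (Sum.inr b) := by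
  simp [or_imp, forall_and]

/-- An environment multiset splits uniquely into its two summands. This is what handles abstraction:
evaluating a body in an extended environment is applying its curried form. -/
theorem mem_image_iff_kcurry {R : SetRel (Multiset (Z ⊕ X)) Y} {s : Set (Z ⊕ X)} {b : Y} :
    b ∈ image R s ↔
      ∃ m, (m, b) ∈ image (kcurry R) (Sum.inl ⁻¹' s) ∧ ∀ a ∈ m, Sum.inr a ∈ s := by
  constructor
  · rintro ⟨ν, hν, hs⟩
    obtain ⟨μ, m, rfl⟩ := exists_map_inl_add_map_inr ν
    obtain ⟨h₁, h₂⟩ := forall_mem_map_add_map.1 hs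
    exact ⟨m, ⟨μ, mem_kcurry.2 hν, h₁⟩, h₂⟩
  · rintro ⟨m, ⟨μ, hμ, h₁⟩, h₂⟩
    exact ⟨_, mem_kcurry.1 hμ, forall_mem_map_add_map.2 ⟨h₁, h₂⟩⟩

end RelModel

/-! ### Pointwise description of `ScottL_!` and comparison with `Rel_!`. -/

namespace ScottL

variable {X : Type u} {Y : Type v} {Z : Type w}
variable {P : PreorderOn X} {Q : PreorderOn Y} {T : PreorderOn Z}

theorem subset_downClosure (P : PreorderOn X) (s : Set X) : s ⊆ downClosure P s :=
  fun a ha => ⟨a, ha, P.le_refl a⟩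

theorem mem_downClosure_of_le {s : Set X} {a b : X} (h : P.le a b) (hb : b ∈ downClosure P s) :
    a ∈ downClosure P s :=
  let ⟨c, hc, hbc⟩ := hb
  ⟨c, hc, P.le_trans _ _ _ h hbc⟩

theorem inl_mem_downClosure {s : Set (X ⊕ Y)} {a : X} :
    Sum.inl a ∈ downClosure (withObj P Q) s ↔ a ∈ downClosure P (Sum.inl ⁻¹' s) := by
  constructor
  · rintro ⟨_, hb, ⟨h⟩ | _⟩
    exact ⟨_, hb, h⟩
  · rintro ⟨b, hb, h⟩
    exact ⟨_, hb, .inl h⟩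

theorem inr_mem_downClosure {s : Set (X ⊕ Y)} {b : Y} :
    Sum.inr b ∈ downClosure (withObj P Q) s ↔ b ∈ downClosure Q (Sum.inr ⁻¹' s) := by
  constructor
  · rintro ⟨_, hb, _ | ⟨h⟩⟩
    exact ⟨_, hb, h⟩
  · rintro ⟨b, hb, h⟩
    exact ⟨_, hb, .inr h⟩

theorem exists_bang_le {s : Set X} (m : Multiset X) (h : ∀ a ∈ m, a ∈ downClosure P s) :
    ∃ m', (bang P).le m m' ∧ ∀ a ∈ m', a ∈ s := by
  choose f hf hle using h
  refine ⟨m.attach.map fun a => f a.1 a.2, fun a ha => ⟨f a ha, ?_, hle a ha⟩, fun a ha => ?_⟩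
  · exact Multiset.mem_map.2 ⟨⟨a, ha⟩, Multiset.mem_attach _ _, rfl⟩
  · obtain ⟨b, -, rfl⟩ := Multiset.mem_map.1 ha
    exact hf _ _

/-- Unlike in `Rel_!`, the input is not split among the elements of `ν`: every multiset produced by
digging lies below `μ`, so each element may consume the whole of `μ`. -/
theorem mem_kcomp {f : Hom (bang P) Q} {g : Hom (bang Q) T} {μ : Multiset X} {c : Z} :
    (μ, c) ∈ (kcomp f g).rel ↔ ∃ ν, (∀ b ∈ ν, (μ, b) ∈ f.rel) ∧ (ν, c) ∈ g.rel := by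
  constructor
  · rintro ⟨ν, ⟨ξ, hξ, hf⟩, hg⟩
    refine ⟨ν, fun b hb => ?_, hg⟩
    obtain ⟨n, hn, hnb⟩ := hf b hb
    exact f.down hnb (hξ n hn) (Q.le_refl b)
  · rintro ⟨ν, hf, hg⟩
    refine ⟨ν, ⟨{μ}, fun n hn => ?_, fun b hb => ⟨μ, Multiset.mem_singleton_self μ, hf b hb⟩⟩, hg⟩
    rw [Multiset.mem_singleton.1 hn]
    exact (bang P).le_refl μ

theorem mem_kfst {μ : Multiset (X ⊕ Y)} {a : X} :
    (μ, a) ∈ (kfst P Q).rel ↔ ∃ a', Sum.inl a' ∈ μ ∧ P.le a a' := by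
  constructor
  · rintro ⟨c, ⟨d, hd, hcd⟩, ⟨e, b⟩, he, hbc, hab⟩
    change e = Sum.inl b at he
    subst he
    obtain ⟨hbd⟩ | _ := (withObj P Q).le_trans _ _ _ hbc hcd
    exact ⟨_, hd, P.le_trans _ _ _ hab hbd⟩
  · rintro ⟨a', ha', h⟩
    exact ⟨Sum.inl a', ⟨_, ha', (withObj P Q).le_refl _⟩, (Sum.inl a', a'), rfl,
      (withObj P Q).le_refl _, h⟩

theorem mem_ksnd {μ : Multiset (X ⊕ Y)} {b : Y} :
    (μ, b) ∈ (ksnd P Q).rel ↔ ∃ b', Sum.inr b' ∈ μ ∧ Q.le b b' := by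
  constructor
  · rintro ⟨c, ⟨d, hd, hcd⟩, ⟨e, b⟩, he, hbc, hab⟩
    change e = Sum.inr b at he
    subst he
    obtain _ | ⟨hbd⟩ := (withObj P Q).le_trans _ _ _ hbc hcd
    exact ⟨_, hd, Q.le_trans _ _ _ hab hbd⟩
  · rintro ⟨a', ha', h⟩
    exact ⟨Sum.inr a', ⟨_, ha', (withObj P Q).le_refl _⟩, (Sum.inr a', a'), rfl,
      (withObj P Q).le_refl _, h⟩

theorem mem_kcurry {f : Hom (bang (withObj T P)) Q} {μ : Multiset Z} {m : Multiset X} {b : Y} :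
    (μ, (m, b)) ∈ (kcurry f).rel ↔ (μ.map Sum.inl + m.map Sum.inr, b) ∈ f.rel := by
  constructor
  · rintro ⟨ν, ⟨h₁, h₂⟩, h⟩
    refine f.down h ?_ (Q.le_refl b)
    rintro (a | a) ha
    · obtain ⟨c, hc, hac⟩ := h₁ a ha
      exact ⟨Sum.inl c, Multiset.mem_add.2 (.inl (Multiset.mem_map_of_mem _ hc)), .inl hac⟩
    · obtain ⟨c, hc, hac⟩ := h₂ a ha
      exact ⟨Sum.inr c, Multiset.mem_add.2 (.inr (Multiset.mem_map_of_mem _ hc)), .inr hac⟩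
  · intro h
    refine ⟨_, ⟨fun a ha => ⟨a, ?_, T.le_refl a⟩, fun a ha => ⟨a, ?_, P.le_refl a⟩⟩, h⟩
    · simpa using ha
    · simpa using ha

theorem mem_kev {ν : Multiset ((Multiset X × Y) ⊕ X)} {b : Y} :
    (ν, b) ∈ (kev P Q).rel ↔ ∃ m : Multiset X,
      Sum.inl (m, b) ∈ downClosure (withObj (lolli (bang P) Q) P) {c | c ∈ ν} ∧
      ∀ a ∈ m, Sum.inr a ∈ downClosure (withObj (lolli (bang P) Q) P) {c | c ∈ ν} := by
  constructor
  · rintro ⟨⟨⟨m, b₁⟩, n⟩, ⟨⟨φ, n'⟩, ⟨⟨ν', ψ, k⟩, hsee, hν, hφ, hn'⟩, ⟨d, hd, hmd⟩, hn⟩,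
      ⟨⟨⟨m', b₂⟩, n₂⟩, b₃⟩, hev, ⟨hm, hn₂⟩, hb⟩
    change (m', b₂) = (n₂, b₃) at hev
    cases hev
    change ν' = ψ.map Sum.inl + k.map Sum.inr at hsee
    subst hsee
    -- The down-closed evaluation gives only `m ≤ n`. The supplied argument `n` is the right
    -- witness, since by contravariance enlarging the argument lowers the point of the function
    -- space.
    refine ⟨n, ?_, fun a ha => ?_⟩
    · obtain ⟨e, he, hde⟩ := hφ d hd
      have hle : (lolli (bang P) Q).le (n, b) e :=
        (lolli _ _).le_trans _ _ _
          ((lolli (bang P) Q).le_trans (n, b) (m, b₁) d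
            ⟨(bang P).le_trans _ _ _ hm.1 hn₂, Q.le_trans _ _ _ hb hm.2⟩ hmd) hde
      obtain ⟨c, hc, hec⟩ := hν (Sum.inl e) (by simpa using he)
      exact ⟨c, hc, (withObj _ _).le_trans _ _ _ (.inl hle) hec⟩
    · obtain ⟨e, he, hae⟩ := (bang P).le_trans _ _ _ hn hn' a ha
      obtain ⟨c, hc, hec⟩ := hν (Sum.inr e) (by simpa using he)
      exact ⟨c, hc, (withObj _ _).le_trans _ _ _ (.inr hae) hec⟩
  · rintro ⟨m, hφ, hm⟩
    refine ⟨((m, b), m), ⟨({(m, b)}, m),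
      ⟨(({(m, b)} : Multiset _).map Sum.inl + m.map Sum.inr, ({(m, b)}, m)),
      rfl, ?_, (tensorObj _ _).le_refl _⟩,
      ⟨(m, b), Multiset.mem_singleton_self _, (lolli _ _).le_refl _⟩, (bang P).le_refl m⟩,
      ⟨(((m, b), m), b), rfl, (tensorObj _ _).le_refl _, Q.le_refl b⟩⟩
    refine RelModel.forall_mem_map_add_map.2 ⟨fun a ha => ?_, hm⟩
    rw [Multiset.mem_singleton.1 ha]
    exact hφ

/-- The slack in `kev` is absorbed by down-closure of `f` and `g`, leaving plain relational
application with `μ` shared. -/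
theorem mem_kcomp_pair_kev {f : Hom (bang T) (lolli (bang P) Q)} {g : Hom (bang T) P}
    {μ : Multiset Z} {b : Y} :
    (μ, b) ∈ (kcomp (pair f g) (kev P Q)).rel ↔
      ∃ m, (μ, (m, b)) ∈ f.rel ∧ ∀ a ∈ m, (μ, a) ∈ g.rel := by
  have hl {x} : (μ, Sum.inl x) ∈ (pair f g).rel ↔ (μ, x) ∈ f.rel := by
    cases x; simp [pair, RelModel.pair]
  have hr {x} : (μ, Sum.inr x) ∈ (pair f g).rel ↔ (μ, x) ∈ g.rel := by
    simp [pair, RelModel.pair]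
  rw [mem_kcomp]
  constructor
  · rintro ⟨ν, hν, hkev⟩
    obtain ⟨m, ⟨c, hc, hle⟩, hm⟩ := mem_kev.1 hkev
    refine ⟨m, hl.1 ((pair f g).down (hν c hc) ((bang T).le_refl μ) hle), fun a ha => ?_⟩
    obtain ⟨d, hd, had⟩ := hm a ha
    exact hr.1 ((pair f g).down (hν d hd) ((bang T).le_refl μ) had)
  · rintro ⟨m, hf, hg⟩
    refine ⟨Sum.inl (m, b) ::ₘ m.map Sum.inr, fun c hc => ?_, mem_kev.2 ⟨m,
      subset_downClosure _ _ (Multiset.mem_cons_self _ _), fun a ha => subset_downClosure _ _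
        (Multiset.mem_cons_of_mem (Multiset.mem_map_of_mem _ ha))⟩⟩
    rcases Multiset.mem_cons.1 hc with rfl | hc
    · exact hl.2 hf
    · obtain ⟨a, ha, rfl⟩ := Multiset.mem_map.1 hc
      exact hr.2 (hg a ha)

/-- Membership in a morphism of `ScottL_!` only depends on the support. -/
theorem Hom.mem_of_mem_image (f : Hom (bang P) Q) {μ : Multiset X} {b : Y}
    (h : b ∈ RelModel.image f.rel {a | a ∈ μ}) : (μ, b) ∈ f.rel :=
  let ⟨_, hm, hmμ⟩ := h
  f.down hm (fun a ha => ⟨a, hmμ a ha, P.le_refl a⟩) (Q.le_refl b)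

theorem kcomp_rel_subset {R : SetRel (Multiset X) Y} {S : SetRel (Multiset Y) Z}
    {f : Hom (bang P) Q} {g : Hom (bang Q) T} (hR : R ⊆ f.rel) (hS : S ⊆ g.rel) :
    RelModel.kcomp R S ⊆ (kcomp f g).rel := by
  rintro ⟨μ, c⟩ h
  have : c ∈ RelModel.image (RelModel.kcomp R S) {a | a ∈ μ} := ⟨μ, h, fun _ ha => ha⟩
  rw [RelModel.image_kcomp] at this
  obtain ⟨ν, hν, hb⟩ := this
  exact mem_kcomp.2 ⟨ν, fun b hbν => f.mem_of_mem_image <|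
    let ⟨m, hm, hmμ⟩ := hb b hbν
    ⟨m, hR hm, hmμ⟩, hS hν⟩

theorem kfst_rel_subset : RelModel.kfst ⊆ (kfst P Q).rel := by
  rintro ⟨μ, a⟩ h
  obtain rfl := RelModel.mem_kfst.1 h
  exact mem_kfst.2 ⟨a, Multiset.mem_singleton_self _, P.le_refl a⟩

theorem ksnd_rel_subset : RelModel.ksnd ⊆ (ksnd P Q).rel := by
  rintro ⟨μ, b⟩ h
  obtain rfl := RelModel.mem_ksnd.1 h
  exact mem_ksnd.2 ⟨b, Multiset.mem_singleton_self _, Q.le_refl b⟩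

theorem kev_rel_subset : RelModel.kev ⊆ (kev P Q).rel := by
  rintro ⟨ν, b⟩ h
  obtain ⟨m, rfl⟩ := RelModel.mem_kev.1 h
  exact mem_kev.2 ⟨m, subset_downClosure _ _ (Multiset.mem_cons_self _ _), fun a ha =>
    subset_downClosure _ _ (Multiset.mem_cons_of_mem (Multiset.mem_map_of_mem _ ha))⟩

theorem pair_rel_subset {R : SetRel Z X} {S : SetRel Z Y} {f : Hom T P} {g : Hom T Q}
    (hR : R ⊆ f.rel) (hS : S ⊆ g.rel) : RelModel.pair R S ⊆ (pair f g).rel := by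
  rintro ⟨c, d⟩ (⟨a, ha, h⟩ | ⟨b, hb, h⟩)
  · exact .inl ⟨a, ha, hR h⟩
  · exact .inr ⟨b, hb, hS h⟩

end ScottL

/-! ### The logical relation and the collapse theorem. -/

open RelModel (image)
open ScottL (downClosure)

theorem Var.rel_subset_scott (C : Type u) {Γ : Ctx} {A : Ty} (x : Var Γ A) :
    Var.rel C x ⊆ (Var.scott C x).rel := by
  induction x with
  | here => exact ScottL.ksnd_rel_subset
  | there x ih => exact ScottL.kcomp_rel_subset ScottL.kfst_rel_subset ih

theorem Term.rel_subset_scott (C : Type u) {Γ : Ctx} {A : Ty} (M : Term Γ A) :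
    Term.rel C M ⊆ (Term.scott C M).rel := by
  induction M with
  | var x => exact Var.rel_subset_scott C x
  | lam M ih =>
    rintro ⟨μ, m, b⟩ h
    exact ScottL.mem_kcurry.2 (ih (RelModel.mem_kcurry.1 h))
  | app M N ihM ihN =>
    exact ScottL.kcomp_rel_subset (ScottL.pair_rel_subset ihM ihN) ScottL.kev_rel_subset

/-- The logical relation: hereditarily, application in `Rel_!` commutes with down-closure. -/
def Ty.Adequate (C : Type u) : (A : Ty) → Set (Ty.web C A) → Prop
  | .base, _ => True
  | .arrow A B, (s : SetRel (Multiset (Ty.web C A)) (Ty.web C B)) =>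
      ∀ t, Ty.Adequate C A t → Ty.Adequate C B (image s t) ∧
        ∀ m b, (m, b) ∈ s → (∀ a ∈ m, a ∈ downClosure (Ty.scott C A) t) →
          b ∈ downClosure (Ty.scott C B) (image s t)

/-- Adequacy of environments, componentwise. -/
def Ctx.Adequate (C : Type u) : (Γ : Ctx) → Set (Ctx.web C Γ) → Prop
  | [], _ => True
  | A :: Γ, (s : Set (Ctx.web C Γ ⊕ Ty.web C A)) =>
      Ctx.Adequate C Γ (Sum.inl ⁻¹' s) ∧ Ty.Adequate C A (Sum.inr ⁻¹' s)

/-- At an arrow type, if `m` is only dominated by `m'` drawn from `t`, contravariance moves `(m, b)`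
down to `(m', b)`, which is again in `s`; images inherit down-closure from the codomain. -/
theorem Ty.adequate_of_downClosed (C : Type u) (A : Ty) (s : Set (Ty.web C A))
    (hs : ∀ a b, (Ty.scott C A).le a b → b ∈ s → a ∈ s) : Ty.Adequate C A s := by
  induction A with
  | base => trivial
  | arrow A B _ ihB =>
    refine fun t _ => ⟨ihB _ ?_, fun m b hmb hm => ?_⟩
    · rintro a b hab ⟨m, hm, hmt⟩
      exact ⟨m, hs (m, a) (m, b) ⟨(ScottL.bang _).le_refl m, hab⟩ hm, hmt⟩
    · obtain ⟨m', hle, hm'⟩ := ScottL.exists_bang_le m hm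
      exact ScottL.subset_downClosure _ _
        ⟨m', hs (m', b) (m, b) ⟨hle, (Ty.scott C B).le_refl b⟩ hmb, hm'⟩

theorem Ctx.adequate_of_downClosed (C : Type u) (Γ : Ctx) (s : Set (Ctx.web C Γ))
    (hs : ∀ a b, (Ctx.scott C Γ).le a b → b ∈ s → a ∈ s) : Ctx.Adequate C Γ s := by
  induction Γ with
  | nil => trivial
  | cons A Γ ih =>
    exact ⟨ih _ fun a b h hb => hs (Sum.inl a) (Sum.inl b) (.inl h) hb,
      Ty.adequate_of_downClosed C A _ fun a b h hb => hs (Sum.inr a) (Sum.inr b) (.inr h) hb⟩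

theorem Var.adequate (C : Type u) {Γ : Ctx} {A : Ty} (x : Var Γ A) (s : Set (Ctx.web C Γ))
    (hs : Ctx.Adequate C Γ s) :
    Ty.Adequate C A (image (Var.rel C x) s) ∧
      ∀ μ b, (μ, b) ∈ (Var.scott C x).rel → (∀ c ∈ μ, c ∈ downClosure (Ctx.scott C Γ) s) →
        b ∈ downClosure (Ty.scott C A) (image (Var.rel C x) s) := by
  induction x with
  | here =>
    rw [show image (Var.rel C .here) s = _ from RelModel.image_ksnd s]
    refine ⟨hs.2, fun μ b hb hμ => ?_⟩
    obtain ⟨b', hb', hle⟩ := ScottL.mem_ksnd.1 hb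
    exact ScottL.mem_downClosure_of_le hle (ScottL.inr_mem_downClosure.1 (hμ _ hb'))
  | there x ih =>
    rw [show image (Var.rel C (.there x)) s = image (Var.rel C x) (Sum.inl ⁻¹' s) from
      (RelModel.image_kcomp _ _ _).trans (congrArg _ (RelModel.image_kfst s))]
    obtain ⟨h₁, h₂⟩ := ih _ hs.1
    refine ⟨h₁, fun μ b hb hμ => ?_⟩
    obtain ⟨ν, hν, hb⟩ := ScottL.mem_kcomp.1 hb
    refine h₂ ν b hb fun c hc => ?_
    obtain ⟨c', hc', hle⟩ := ScottL.mem_kfst.1 (hν c hc)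
    exact ScottL.mem_downClosure_of_le hle (ScottL.inl_mem_downClosure.1 (hμ _ hc'))

/-- The fundamental lemma of the logical relation. -/
theorem Term.adequate (C : Type u) {Γ : Ctx} {A : Ty} (M : Term Γ A) (s : Set (Ctx.web C Γ))
    (hs : Ctx.Adequate C Γ s) :
    Ty.Adequate C A (image (Term.rel C M) s) ∧
      ∀ μ b, (μ, b) ∈ (Term.scott C M).rel → (∀ c ∈ μ, c ∈ downClosure (Ctx.scott C Γ) s) →
        b ∈ downClosure (Ty.scott C A) (image (Term.rel C M) s) := by
  induction M with
  | var x => exact Var.adequate C x s hs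
  | @lam Γ A B M ih =>
    have hext (t : Set (Ty.web C A)) (ht : Ty.Adequate C A t) :=
      ih (Sum.elim s t : Ctx.web C Γ ⊕ Ty.web C A → Prop) ⟨hs, ht⟩
    have himage (t : Set (Ty.web C A)) :
        image (Term.rel C M) (Sum.elim s t : Ctx.web C Γ ⊕ Ty.web C A → Prop) =
          image (image (RelModel.kcurry (Term.rel C M)) s) t :=
      Set.ext fun b => RelModel.mem_image_iff_kcurry
    have henv {t : Set (Ty.web C A)} {μ : Multiset (Ctx.web C Γ)} {m : Multiset (Ty.web C A)}
        (hμ : ∀ c ∈ μ, c ∈ downClosure (Ctx.scott C Γ) s)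
        (hm : ∀ a ∈ m, a ∈ downClosure (Ty.scott C A) t) :
        ∀ c ∈ μ.map Sum.inl + m.map Sum.inr, c ∈ downClosure (Ctx.scott C (A :: Γ))
          (Sum.elim s t : Ctx.web C Γ ⊕ Ty.web C A → Prop) :=
      RelModel.forall_mem_map_add_map.2 ⟨fun c hc => ScottL.inl_mem_downClosure.2 (hμ c hc),
        fun a ha => ScottL.inr_mem_downClosure.2 (hm a ha)⟩
    constructor
    · intro t ht
      obtain ⟨h₁, h₂⟩ := hext t ht
      rw [himage] at h₁ h₂
      refine ⟨h₁, ?_⟩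
      rintro m b ⟨μ, hμ, hμs⟩ hm
      -- The body's `Rel_!` point need not match `t` exactly; viewed as a `ScottL_!` point it falls
      -- under the induction hypothesis, which tolerates the gap.
      exact h₂ _ b (Term.rel_subset_scott C M (RelModel.mem_kcurry.1 hμ))
        (henv (fun c hc => ScottL.subset_downClosure _ _ (hμs c hc)) hm)
    · rintro μ ⟨m, b⟩ hb hμ
      -- With this choice of argument set, `m'` drawn from it means `m' ≤ m`, the contravariant half
      -- of `(m, b) ≤ (m', b')`.
      obtain ⟨-, h₂⟩ := hext (downClosure (Ty.scott C A) {a | a ∈ m})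
        (Ty.adequate_of_downClosed C A _ fun _ _ => ScottL.mem_downClosure_of_le)
      rw [himage] at h₂
      obtain ⟨b', ⟨m', hm', hle⟩, hbb'⟩ := h₂ _ b (ScottL.mem_kcurry.1 hb) (henv hμ fun a ha =>
        ScottL.subset_downClosure _ _ (ScottL.subset_downClosure _ _ ha))
      exact ⟨(m', b'), hm', hle, hbb'⟩
  | @app Γ A B M N ihM ihN =>
    rw [show image (Term.rel C (.app M N)) s = _ from RelModel.image_kcomp_pair_kev _ _ s]
    obtain ⟨hM₁, hM₂⟩ := ihM s hs
    obtain ⟨hN₁, hN₂⟩ := ihN s hs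
    refine ⟨(hM₁ _ hN₁).1, fun μ b hb hμ => ?_⟩
    obtain ⟨m, hmb, hm⟩ := ScottL.mem_kcomp_pair_kev.1 hb
    obtain ⟨⟨m', b'⟩, hmb', hle, hbb'⟩ := hM₂ μ (m, b) hmb hμ
    -- The elements of `m'` lie only in the closure of the image of `N`; adequacy of the image of
    -- `M` is exactly what permits applying it there.
    refine ScottL.mem_downClosure_of_le hbb' ((hM₁ _ hN₁).2 m' b' hmb' fun a ha => ?_)
    obtain ⟨c, hc, hac⟩ := hle a ha
    exact ScottL.mem_downClosure_of_le hac (hN₂ μ c (hm c hc) hμ)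

theorem mainTheorem5 (C : Type u) (Γ : Ctx) (A : Ty) (M : Term Γ A) :
    (Term.scott C M).rel =
      ScottL.downClosure (ScottL.lolli (ScottL.bang (Ctx.scott C Γ)) (Ty.scott C A))
        (Term.rel C M) := by
  apply Set.Subset.antisymm
  · rintro ⟨μ, a⟩ h
    obtain ⟨a', ⟨μ', hμ', hle⟩, haa'⟩ :=
      (Term.adequate C M (downClosure (Ctx.scott C Γ) {c | c ∈ μ})
        (Ctx.adequate_of_downClosed C Γ _ fun _ _ => ScottL.mem_downClosure_of_le)).2 μ a h
        fun c hc => ScottL.subset_downClosure _ _ (ScottL.subset_downClosure _ _ hc)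
    exact ⟨(μ', a'), hμ', hle, haa'⟩
  · rintro ⟨μ, a⟩ ⟨⟨μ', a'⟩, h, hμ, ha⟩
    exact (Term.scott C M).down (Term.rel_subset_scott C M h) hμ ha
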